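/- Let $R$ be a commutative ring with unity, let $k\ge 1$ be an integer, let $I_0,\dots,I_k$ be ideals of $R$ with $I_i+I_j=R$ for $i\ne j$, put $I=\prod_{i=0}^k I_i$, and let $m^i_j$ $(0\le i,j\le k)$ be non-negative integers. Definitions. A finite sequence of elements of $R$ is unital if its entries generate the unit ideal. An ideal $\mathfrak a\subsetneq R$ satisfies the unital set condition (USC) if for every $n\ge 2$ and every unital sequence $a_1,\dots,a_n\in R$ there is $b\in\langle a_2,\dots,a_n\rangle$ such that $a_1+b$ is a unit modulo $\mathfrak a$. For an ideal $\mathfrak a\subseteq R$ and non-negative integers $m_0,\dots,m_k$, the generalized projective space $\mathbb{PF}^{k,(m_0,\dots,m_k)}_{\mathfrak a}$ is the set of unital vectors $(a_0,\dots,a_k)\in R^{k+1}$ modulo the equivalence relation under which $(a_j)\sim(b_j)$ if and only if there is $\lambda\in R$ that is a unit modulo $\mathfrak a$ with $a_j\equiv\lambda^{m_j}b_j \pmod{\mathfrak a}$ for all $0\le j\le k$ (for $\mathfrak a=R$ it is a single point); the class of $(a_0,\dots,a_k)$ is written $[a_0:\dots:a_k]$. For an ideal $J\subseteq R$ let $\Gamma_k(J)$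 be the kernel of $SL_{k+1}(R)\to SL_{k+1}(R/J)$. A subgroup of $SL_{k+1}(R)$ is a congruence ideal subgroup if it contains $\Gamma_k(J)$ for some ideal $J\subseteq R$. Theorem. Let $\Gamma\subseteq SL_{k+1}(R)$ be a subgroup and consider the map $$\Gamma\longrightarrow\prod_{i=0}^k\mathbb{PF}^{k,(m^i_0,\dots,m^i_k)}_{I_i},\qquad [a_{i,j}]_{0\le i,j\le k}\longmapsto\big([a_{0,0}:\dots:a_{0,k}],\dots,[a_{k,0}:\dots:a_{k,k}]\big).$$ 1. If $I$ satisfies the USC or $I=R$, if $\Gamma$ is a congruence ideal subgroup, and if $\Gamma\,\Gamma_k(I)=SL_{k+1}(R)$, then this map is surjective. 2. In particular, if $\Gamma\supseteq\Gamma_k(J)$ for some ideal $J\subseteq R$ with $J+I=R$, and $IJ$ satisfies the USC or $IJ=R$, then this map is surjective. -/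

import Mathlib

open scoped Pointwise

namespace CongrSurj

/-- A finite sequence of elements of `R` is unital if its entries generate the unit ideal. -/
def IsUnital {R : Type*} [CommRing R] {n : ℕ} (a : Fin n → R) : Prop :=
  Ideal.span (Set.range a) = ⊤

/-- The unital set condition for a (proper) ideal: for every unital sequence with at least two
entries there is an element `b` of the ideal generated by all entries but the first, such that
(first entry) `+ b` is a unit modulo `I`. -/
def USC {R : Type*} [CommRing R] (I : Ideal R) : Prop :=
  I ≠ ⊤ ∧ ∀ (n : ℕ) (a : Fin (n + 2) → R), IsUnital a →
    ∃ b ∈ Ideal.span (Set.range fun j : Fin (n + 1) => a j.succ),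
      IsUnit (Ideal.Quotient.mk I (a 0 + b))

/-- The set of unital vectors of length `k + 1`. -/
def GCD (k : ℕ) (R : Type*) [CommRing R] : Type _ :=
  {a : Fin (k + 1) → R // IsUnital a}

/-- `a` and `b` are related if, for some `l` which is a unit modulo `I`, one has
`a j ≡ l ^ m j * b j` modulo `I` for all `j`. For `I = ⊤` any two elements are related
(see `projRel_top`). -/
def ProjRel {R : Type*} [CommRing R] {k : ℕ} (I : Ideal R) (m : Fin (k + 1) → ℕ)
    (a b : GCD k R) : Prop :=
  ∃ l : R, IsUnit (Ideal.Quotient.mk I l) ∧ ∀ j, a.1 j - l ^ m j * b.1 j ∈ I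

theorem projRel_top {R : Type*} [CommRing R] {k : ℕ} (m : Fin (k + 1) → ℕ) (a b : GCD k R) :
    ProjRel (⊤ : Ideal R) m a b :=
  ⟨1, by simp, fun _ => Submodule.mem_top⟩

theorem projRel_equivalence {R : Type*} [CommRing R] {k : ℕ} (I : Ideal R)
    (m : Fin (k + 1) → ℕ) : Equivalence (ProjRel I m) where
  refl a := ⟨1, by simp, fun j => by simp⟩
  symm := by
    rintro a b ⟨l, hl, h⟩
    obtain ⟨u, hu⟩ := hl
    obtain ⟨l', hl'⟩ := Ideal.Quotient.mk_surjective (I := I) (↑u⁻¹ : R ⧸ I)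
    refine ⟨l', hl' ▸ Units.isUnit _, fun j => ?_⟩
    have hj := Ideal.Quotient.mk_eq_mk_iff_sub_mem (I := I) _ _ |>.mpr (h j)
    refine Ideal.Quotient.mk_eq_mk_iff_sub_mem (I := I) _ _ |>.mp ?_
    rw [map_mul, map_pow, hj, hl', map_mul, map_pow, ← hu, ← mul_assoc, ← mul_pow]
    simp
  trans := by
    rintro a b c ⟨l, hl, h⟩ ⟨l', hl', h'⟩
    refine ⟨l * l', by rw [map_mul]; exact hl.mul hl', fun j => ?_⟩
    have e : a.1 j - (l * l') ^ m j * c.1 j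
        = (a.1 j - l ^ m j * b.1 j) + l ^ m j * (b.1 j - l' ^ m j * c.1 j) := by ring
    rw [e]
    exact I.add_mem (h j) (I.mul_mem_left _ (h' j))

/-- The equivalence relation defining the generalized projective space. -/
def projSetoid {R : Type*} [CommRing R] {k : ℕ} (I : Ideal R) (m : Fin (k + 1) → ℕ) :
    Setoid (GCD k R) :=
  ⟨ProjRel I m, projRel_equivalence I m⟩

/-- The generalized projective space of dimension `k` with weights `m` attached to `I`. -/
def PF {R : Type*} [CommRing R] {k : ℕ} (I : Ideal R) (m : Fin (k + 1) → ℕ) : Type _ :=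
  Quotient (projSetoid I m)

theorem isUnital_row {R : Type*} [CommRing R] {k : ℕ}
    (A : Matrix.SpecialLinearGroup (Fin (k + 1)) R) (i : Fin (k + 1)) :
    IsUnital (fun j => A.1 i j) := by
  refine (Ideal.eq_top_iff_one _).mpr ?_
  have h : (A.1 * A.1.adjugate) i i = 1 := by
    rw [Matrix.mul_adjugate, A.2]; simp
  have h' : (1 : R) = ∑ j, A.1 i j * A.1.adjugate j i := by
    rw [← Matrix.mul_apply]; exact h.symm
  refine Eq.subst (motive := fun x => x ∈ Ideal.span (Set.range fun j => A.1 i j)) h'.symm ?_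
  exact Ideal.sum_mem _ fun j _ =>
    Ideal.mul_mem_right _ _ (Ideal.subset_span ⟨j, rfl⟩)

/-- The map sending a matrix to the tuple of the classes of its rows, row `i` being taken in
the generalized projective space attached to the ideal `I i` and the weights `m i`. -/
def rowMap {R : Type*} [CommRing R] {k : ℕ} (I : Fin (k + 1) → Ideal R)
    (m : Fin (k + 1) → Fin (k + 1) → ℕ) (A : Matrix.SpecialLinearGroup (Fin (k + 1)) R) :
    (i : Fin (k + 1)) → PF (I i) (m i) :=
  fun i => Quotient.mk (projSetoid (I i) (m i)) ⟨fun j => A.1 i j, isUnital_row A i⟩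

/-- The principal congruence ideal subgroup of `SL (k + 1)` over `R` attached to `J`: the kernel
of reduction modulo `J`. -/
def principalCongr {R : Type*} [CommRing R] (k : ℕ) (J : Ideal R) :
    Subgroup (Matrix.SpecialLinearGroup (Fin (k + 1)) R) :=
  (Matrix.SpecialLinearGroup.map (n := Fin (k + 1)) (Ideal.Quotient.mk J)).ker

/-- A congruence ideal subgroup is one containing some principal congruence ideal subgroup. -/
def IsCongruenceIdealSubgroup {R : Type*} [CommRing R] {k : ℕ}
    (G : Subgroup (Matrix.SpecialLinearGroup (Fin (k + 1)) R)) : Prop :=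
  ∃ J : Ideal R, principalCongr k J ≤ G

end CongrSurj

/-! The USC for an ideal below `I'` makes `R ⧸ I'` a ring of stable rank one. Over such a ring every
unital row of length at least two is reduced to `e₀` by transvections, and transvections lift along
surjections. Hence each unital row modulo `I i` is row `i` of the reduction of some matrix in
`SL(R)` (`exists_map_row_eq`), and `SL(R) → SL(R ⧸ I')` is onto (`map_surjective`). With the Chinese
remainder theorem this gives strong approximation (`exists_forall_map_eq`): one matrix over `R` has
all the prescribed rows modulo the respective `I i`. As `Γ` meets every coset of the kernel modulo
`∏ i, I i`, that matrix may be replaced by one in `Γ`. -/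

namespace CongrSurj

open Matrix

/-- Every unital vector of length at least two can be shortened: a suitable linear combination of
the other entries turns the first one into a unit. -/
def HasStableRankOne (S : Type*) [CommRing S] : Prop :=
  ∀ (n : ℕ) (a : Fin (n + 2) → S), IsUnital a →
    ∃ c : Fin (n + 1) → S, IsUnit (a 0 + ∑ j, c j * a j.succ)

theorem isUnital_iff_exists {S : Type*} [CommRing S] {n : ℕ} (a : Fin n → S) :
    IsUnital a ↔ ∃ c : Fin n → S, ∑ j, c j * a j = 1 := by
  rw [IsUnital, Ideal.eq_top_iff_one]
  exact Ideal.mem_span_range_iff_exists_fun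

theorem IsUnital.map {S T : Type*} [CommRing S] [CommRing T] {n : ℕ} {a : Fin n → S}
    (ha : IsUnital a) (f : S →+* T) : IsUnital (fun j => f (a j)) := by
  obtain ⟨c, hc⟩ := (isUnital_iff_exists a).1 ha
  refine (isUnital_iff_exists _).2 ⟨fun j => f (c j), ?_⟩
  simpa using congrArg f hc

theorem isUnital_single {S : Type*} [CommRing S] {n : ℕ} (i : Fin n) :
    IsUnital (Pi.single i (1 : S)) :=
  (isUnital_iff_exists _).2 ⟨Pi.single i 1, by simp [Pi.single_apply]⟩

/-- A row unital modulo `I'` need not lift to a unital row, but it does after appending its defect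
`t ∈ I'`. The USC applies to the longer row, and the contribution of `t` dies modulo `I'`. -/
theorem USC.hasStableRankOne {R : Type*} [CommRing R] {I I' : Ideal R} (h : USC I)
    (hle : I ≤ I') : HasStableRankOne (R ⧸ I') := by
  intro n a ha
  choose v hv using fun j => Ideal.Quotient.mk_surjective (a j)
  obtain ⟨c, hc⟩ := (isUnital_iff_exists a).1 ha
  choose d hd using fun j => Ideal.Quotient.mk_surjective (c j)
  obtain ⟨t, ht⟩ : ∃ t, ∑ j, d j * v j + t = 1 := ⟨1 - ∑ j, d j * v j, by ring⟩
  have hmem : t ∈ I' := by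
    rw [← Ideal.Quotient.eq_zero_iff_mem]
    simpa [hv, hd, hc] using congrArg (Ideal.Quotient.mk I') ht
  have hw : IsUnital (Fin.snoc v t : Fin (n + 1 + 2) → R) := by
    refine (isUnital_iff_exists _).2 ⟨(Fin.snoc d 1 : Fin (n + 1 + 2) → R), ?_⟩
    rw [Fin.sum_univ_castSucc]
    simpa only [Fin.snoc_castSucc, Fin.snoc_last, one_mul] using ht
  obtain ⟨b, hb, hu⟩ := h.2 (n + 1) _ hw
  obtain ⟨e, rfl⟩ := Ideal.mem_span_range_iff_exists_fun.1 hb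
  refine ⟨fun j => Ideal.Quotient.mk I' (e j.castSucc), ?_⟩
  have hu' := hu.map (Ideal.Quotient.factor hle)
  have h0 : (Fin.snoc v t : Fin (n + 1 + 2) → R) 0 = v 0 :=
    Fin.snoc_castSucc (α := fun _ => R) _ _ 0
  have h1 : ∀ j : Fin (n + 1), (Fin.snoc v t : Fin (n + 1 + 2) → R) j.castSucc.succ = v j.succ :=
    fun j => Fin.snoc_castSucc (α := fun _ => R) _ _ j.succ
  have h2 : (Fin.snoc v t : Fin (n + 1 + 2) → R) (Fin.last (n + 1)).succ = t := by
    rw [Fin.succ_last]; exact Fin.snoc_last (α := fun _ => R) _ _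
  rw [Ideal.Quotient.factor_mk, Fin.sum_univ_castSucc, h0, h2] at hu'
  simpa only [h1, map_add, map_sum, map_mul, hv, Ideal.Quotient.eq_zero_iff_mem.2 hmem, mul_zero,
    add_zero] using hu'

theorem hasStableRankOne_of_usc_or_eq_top {R : Type*} [CommRing R] {I I' : Ideal R}
    (h : USC I ∨ I = ⊤) (hle : I ≤ I') : HasStableRankOne (R ⧸ I') := by
  rcases h with h | rfl
  · exact h.hasStableRankOne hle
  · have := Ideal.Quotient.subsingleton_iff.2 (top_le_iff.1 hle)
    exact fun n a _ => ⟨0, isUnit_of_subsingleton _⟩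

/-- The matrix `1 + u wᵀ`, of determinant one when `w` and `u` are orthogonal. -/
def rankOneUpdate {n : Type*} [Fintype n] [DecidableEq n] {R : Type*} [CommRing R] (u w : n → R)
    (h : w ⬝ᵥ u = 0) : SpecialLinearGroup n R :=
  ⟨1 + vecMulVec u w, by
    rw [vecMulVec_eq Unit, det_one_add_replicateCol_mul_replicateRow, h, add_zero]⟩

theorem vecMul_rankOneUpdate {n : Type*} [Fintype n] [DecidableEq n] {R : Type*} [CommRing R]
    (u w : n → R) (h : w ⬝ᵥ u = 0) (v : n → R) :
    v ᵥ* (rankOneUpdate u w h).1 = v + (v ⬝ᵥ u) • w := by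
  simp [rankOneUpdate, vecMul_add, vecMul_vecMulVec]

theorem map_rankOneUpdate {n : Type*} [Fintype n] [DecidableEq n] {R S : Type*} [CommRing R]
    [CommRing S] (f : R →+* S) (u w : n → R) (h : w ⬝ᵥ u = 0) (h' : (f ∘ w) ⬝ᵥ (f ∘ u) = 0) :
    SpecialLinearGroup.map f (rankOneUpdate u w h) = rankOneUpdate (f ∘ u) (f ∘ w) h' := by
  ext i j
  change f ((1 + vecMulVec u w) i j) = (1 + vecMulVec (f ∘ u) (f ∘ w) : Matrix n n S) i j
  simp [vecMulVec_apply, one_apply, apply_ite f]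

/-! ### Lifting rows and matrices along a surjection -/

section Lifting

variable {R S : Type*} [CommRing R] [CommRing S] (f : R →+* S)

/-- `w` is the image of the row vector `v` under a matrix of determinant one lifting along `f`. -/
def LiftRel {n : Type*} [Fintype n] [DecidableEq n] (v w : n → S) : Prop :=
  ∃ g : SpecialLinearGroup n R, v ᵥ* (SpecialLinearGroup.map f g).1 = w

theorem LiftRel.trans {n : Type*} [Fintype n] [DecidableEq n] {u v w : n → S}
    (h₁ : LiftRel f u v) (h₂ : LiftRel f v w) : LiftRel f u w := by
  obtain ⟨g₁, rfl⟩ := h₁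
  obtain ⟨g₂, rfl⟩ := h₂
  refine ⟨g₁ * g₂, ?_⟩
  rw [map_mul]
  exact (vecMul_vecMul _ _ _).symm

theorem LiftRel.symm {n : Type*} [Fintype n] [DecidableEq n] {v w : n → S}
    (h : LiftRel f v w) : LiftRel f w v := by
  obtain ⟨g, rfl⟩ := h
  refine ⟨g⁻¹, (vecMul_vecMul _ _ _).trans ?_⟩
  have h : (SpecialLinearGroup.map f g).1 * (SpecialLinearGroup.map f g⁻¹).1 = 1 :=
    congrArg Subtype.val (show SpecialLinearGroup.map f g * SpecialLinearGroup.map f g⁻¹ = 1 by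
      rw [← map_mul, mul_inv_cancel, map_one])
  rw [h, vecMul_one]

theorem liftRel_add_head (hf : Function.Surjective f) {n : ℕ} (c : Fin n → S)
    (v : Fin (n + 1) → S) : LiftRel f v (v + Pi.single 0 (∑ j, c j * v j.succ)) := by
  choose d hd using fun j => hf (c j)
  refine ⟨rankOneUpdate (Fin.cons 0 d) (Pi.single 0 1) (by simp), ?_⟩
  have h : f ∘ (Pi.single 0 1 : Fin (n + 1) → R) = Pi.single 0 1 := by
    ext j; simp [Pi.single_apply, apply_ite f]
  rw [map_rankOneUpdate f _ _ _ (by rw [h]; simp), vecMul_rankOneUpdate, h]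
  congr 1
  ext j
  simp [dotProduct, Fin.sum_univ_succ, hd, Pi.single_apply, mul_comm]

theorem liftRel_add_tail (hf : Function.Surjective f) {n : ℕ} (c : Fin n → S)
    (v : Fin (n + 1) → S) : LiftRel f v (v + v 0 • (Fin.cons 0 c : Fin (n + 1) → S)) := by
  choose d hd using fun j => hf (c j)
  refine ⟨rankOneUpdate (Pi.single 0 1) (Fin.cons 0 d) (by simp), ?_⟩
  have h : f ∘ (Pi.single 0 1 : Fin (n + 1) → R) = Pi.single 0 1 := by
    ext j; simp [Pi.single_apply, apply_ite f]
  have h' : f ∘ (Fin.cons 0 d : Fin (n + 1) → R) = Fin.cons 0 c := by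
    ext j; refine Fin.cases ?_ (fun j => ?_) j <;> simp [hd]
  rw [map_rankOneUpdate f _ _ _ (by rw [h, h']; simp), vecMul_rankOneUpdate, h, h']
  simp

theorem liftRel_single_zero (hf : Function.Surjective f) (hS : HasStableRankOne S) {n : ℕ}
    (v : Fin (n + 2) → S) (hv : IsUnital v) : LiftRel f v (Pi.single 0 1) := by
  -- The chain is `v → (u, tail) → (u, 1, 0, …) → (1, 1, 0, …) → e₀`; the unit `u` lets the second
  -- step replace the tail by any vector.
  obtain ⟨c, u, hu⟩ := hS n v hv
  have h₁ : LiftRel f v (Fin.cons (u : S) fun j => v j.succ) := by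
    convert liftRel_add_head f hf c v using 1
    ext j; refine Fin.cases ?_ (fun j => ?_) j <;> simp [hu]
  have h₂ : LiftRel f (Fin.cons (u : S) fun j => v j.succ)
      (Fin.cons (u : S) (Pi.single 0 1) : Fin (n + 2) → S) := by
    convert liftRel_add_tail f hf
      (fun j : Fin (n + 1) => (↑u⁻¹ : S) * ((Pi.single 0 1 : Fin (n + 1) → S) j - v j.succ)) _
      using 1
    ext j; refine Fin.cases ?_ (fun j => ?_) j <;> simp
  have h₃ : LiftRel f (Fin.cons (u : S) (Pi.single 0 1) : Fin (n + 2) → S)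
      (Fin.cons 1 (Pi.single 0 1)) := by
    convert liftRel_add_head f hf (Pi.single (0 : Fin (n + 1)) (1 - (u : S))) _ using 1
    ext j; refine Fin.cases ?_ (fun j => ?_) j <;> simp [Pi.single_apply]
  have h₄ : LiftRel f (Fin.cons 1 (Pi.single 0 1) : Fin (n + 2) → S) (Pi.single 0 1) := by
    convert liftRel_add_tail f hf (Pi.single (0 : Fin (n + 1)) (-1 : S)) _ using 1
    ext j; refine Fin.cases ?_ (fun j => ?_) j
    · simp
    · by_cases h : j = 0 <;> simp [h]
  exact ((h₁.trans f h₂).trans f h₃).trans f h₄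

/-- Unital vectors over a ring of stable rank one are rows of liftable matrices. -/
theorem exists_map_row_eq (hf : Function.Surjective f) (hS : HasStableRankOne S) {n : ℕ}
    (v : Fin (n + 2) → S) (hv : IsUnital v) (i : Fin (n + 2)) :
    ∃ g : SpecialLinearGroup (Fin (n + 2)) R, (SpecialLinearGroup.map f g).1 i = v := by
  -- Both `eᵢ` and `v` lie in the orbit of `e₀`; a matrix carrying `eᵢ` to `v` has `v` as row `i`.
  obtain ⟨g, hg⟩ := (liftRel_single_zero f hf hS _ (isUnital_single i)).trans f
    ((liftRel_single_zero f hf hS v hv).symm f)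
  exact ⟨g, (single_one_vecMul i (SpecialLinearGroup.map f g).1).symm.trans hg⟩

theorem det_eq_of_row_zero {n : ℕ} (A : Matrix (Fin (n + 1)) (Fin (n + 1)) R)
    (hA : A 0 = Pi.single 0 1) : A.det = (A.submatrix Fin.succ Fin.succ).det := by
  rw [det_succ_row_zero, Fin.sum_univ_succ]
  simp [hA]

theorem map_surjective (hf : Function.Surjective f) (hS : HasStableRankOne S) (n : ℕ) :
    Function.Surjective
      (SpecialLinearGroup.map f : SpecialLinearGroup (Fin n) R →* SpecialLinearGroup (Fin n) S) := by
  -- When the top row is `e₀`, the determinant is that of the lower right block: lift that block by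
  -- induction and the rest of the first column arbitrarily.
  have key : ∀ n, Function.Surjective (SpecialLinearGroup.map f :
      SpecialLinearGroup (Fin n) R →* SpecialLinearGroup (Fin n) S) →
      ∀ A : SpecialLinearGroup (Fin (n + 1)) S, A.1 0 = Pi.single 0 1 →
        ∃ B : SpecialLinearGroup (Fin (n + 1)) R, SpecialLinearGroup.map f B = A := by
    intro n ih A hA
    obtain ⟨B, hB⟩ := ih ⟨A.1.submatrix Fin.succ Fin.succ, by
      rw [← det_eq_of_row_zero A.1 hA, A.2]⟩
    choose d hd using fun i : Fin n => hf (A.1 i.succ 0)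
    refine ⟨⟨Matrix.of (Fin.cons (Pi.single 0 1) fun i => Fin.cons (d i) (B.1 i)), ?_⟩, ?_⟩
    · rw [det_eq_of_row_zero _ rfl]
      exact B.2
    · ext i j
      refine Fin.cases ?_ (fun i => ?_) i
      · change f ((Pi.single 0 1 : Fin (n + 1) → R) j) = A.1 0 j
        rw [hA]
        simp [Pi.single_apply, apply_ite f]
      · refine Fin.cases (hd i) (fun j => ?_) j
        exact congrArg (fun M : SpecialLinearGroup (Fin n) S => M.1 i j) hB
  induction n with
  | zero => exact fun A => ⟨1, Subsingleton.elim _ _⟩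
  | succ n ih =>
    intro A
    cases n with
    | zero =>
      have : Subsingleton (SpecialLinearGroup (Fin (0 + 1)) S) :=
        SpecialLinearGroup.subsingleton_of_subsingleton (n := Fin 1)
      exact ⟨1, Subsingleton.elim _ _⟩
    | succ n =>
      obtain ⟨g, hg⟩ := liftRel_single_zero f hf hS _ (isUnital_row A 0)
      obtain ⟨B, hB⟩ := key _ ih (A * SpecialLinearGroup.map f g) hg
      exact ⟨B * g⁻¹, by rw [map_mul, hB, map_inv, mul_inv_cancel_right]⟩

end Lifting

/-! ### Strong approximation and surjectivity on rows -/

section Quotient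

variable {R : Type*} [CommRing R]

theorem map_mk_eq_iff {n : ℕ} {I : Ideal R} {A B : SpecialLinearGroup (Fin n) R} :
    SpecialLinearGroup.map (Ideal.Quotient.mk I) A =
        SpecialLinearGroup.map (Ideal.Quotient.mk I) B ↔
      ∀ i j, A.1 i j - B.1 i j ∈ I := by
  refine (Matrix.SpecialLinearGroup.ext_iff _ _).trans (forall₂_congr fun i j => ?_)
  exact Ideal.Quotient.mk_eq_mk_iff_sub_mem (A.1 i j) (B.1 i j)

/-- Strong approximation: matrices prescribed modulo finitely many pairwise coprime ideals are
simultaneously congruent to one matrix of determinant one. -/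
theorem exists_forall_map_eq {ι : Type*} [Finite ι] (I : ι → Ideal R)
    (hI : Pairwise (Function.onFun IsCoprime I)) (hS : HasStableRankOne (R ⧸ ⨅ i, I i)) {n : ℕ}
    (G : ι → SpecialLinearGroup (Fin n) R) :
    ∃ B : SpecialLinearGroup (Fin n) R, ∀ i,
      SpecialLinearGroup.map (Ideal.Quotient.mk (I i)) B =
        SpecialLinearGroup.map (Ideal.Quotient.mk (I i)) (G i) := by
  choose M hM using fun p q => Ideal.exists_forall_sub_mem_ideal hI fun i => (G i).1 p q
  -- `M` comes from the Chinese remainder theorem entry by entry, so `det M - 1` lies in every `I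
  -- i`; only its reduction modulo the intersection has determinant one, and that is lifted.
  have hdet : (((Ideal.Quotient.mk (⨅ i, I i)).mapMatrix (Matrix.of M))).det = 1 := by
    rw [← RingHom.map_det, ← map_one (Ideal.Quotient.mk _), Ideal.Quotient.mk_eq_mk_iff_sub_mem,
      Ideal.mem_iInf]
    intro i
    rw [← Ideal.Quotient.mk_eq_mk_iff_sub_mem, RingHom.map_det, ← (G i).2, RingHom.map_det]
    congr 1
    ext p q
    exact (Ideal.Quotient.mk_eq_mk_iff_sub_mem _ _).2 (hM p q i)
  obtain ⟨B, hB⟩ := map_surjective _ Ideal.Quotient.mk_surjective hS n ⟨_, hdet⟩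
  refine ⟨B, fun i => map_mk_eq_iff.2 fun p q => ?_⟩
  have h : B.1 p q - M p q ∈ ⨅ i, I i :=
    (Ideal.Quotient.mk_eq_mk_iff_sub_mem _ _).1
      (congrArg (fun A : SpecialLinearGroup (Fin n) (R ⧸ ⨅ i, I i) => A.1 p q) hB)
  simpa using (I i).add_mem (Ideal.mem_iInf.1 h i) (hM p q i)

theorem mem_principalCongr_iff {k : ℕ} {J : Ideal R} {A B : SpecialLinearGroup (Fin (k + 1)) R} :
    A⁻¹ * B ∈ principalCongr k J ↔
      SpecialLinearGroup.map (Ideal.Quotient.mk J) A =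
        SpecialLinearGroup.map (Ideal.Quotient.mk J) B := by
  rw [principalCongr, MonoidHom.mem_ker, map_mul, map_inv, inv_mul_eq_one]

theorem rowMap_surjective {k : ℕ} (hk : 1 ≤ k) (I : Fin (k + 1) → Ideal R)
    (hI : Pairwise (Function.onFun IsCoprime I)) (m : Fin (k + 1) → Fin (k + 1) → ℕ)
    (Γ : Subgroup (SpecialLinearGroup (Fin (k + 1)) R))
    (husc : USC (∏ i, I i) ∨ (∏ i, I i) = ⊤)
    (hΓ : ∀ B, ∃ A ∈ Γ, SpecialLinearGroup.map (Ideal.Quotient.mk (∏ i, I i)) A =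
      SpecialLinearGroup.map (Ideal.Quotient.mk (∏ i, I i)) B) :
    Function.Surjective (fun A : Γ => rowMap I m A.1) := by
  obtain ⟨k, rfl⟩ := Nat.exists_eq_add_of_le' hk
  have hprod : ∏ i, I i = ⨅ i, I i := by
    simpa using Ideal.prod_eq_iInf_of_pairwise_isCoprime (s := Finset.univ) (hI.set_pairwise _)
  have hle : ∀ i, ∏ i, I i ≤ I i := fun i => hprod ▸ iInf_le I i
  intro x
  choose v hv using fun i => Quotient.exists_rep (x i)
  choose G hG using fun i => exists_map_row_eq (Ideal.Quotient.mk (I i))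
    Ideal.Quotient.mk_surjective (hasStableRankOne_of_usc_or_eq_top husc (hle i)) _
    ((v i).2.map (Ideal.Quotient.mk (I i))) i
  obtain ⟨B, hB⟩ := exists_forall_map_eq I hI
    (hasStableRankOne_of_usc_or_eq_top husc hprod.le) G
  obtain ⟨A, hA, hAB⟩ := hΓ B
  refine ⟨⟨A, hA⟩, funext fun i => ?_⟩
  rw [← hv i]
  -- The rows agree modulo `I i` on the nose, so the scalar `1` works for any weights.
  refine Quotient.sound ⟨1, by simp, fun j => ?_⟩
  have h₁ := hle i (map_mk_eq_iff.1 hAB i j)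
  have h₂ := map_mk_eq_iff.1 (hB i) i j
  have h₃ := (Ideal.Quotient.mk_eq_mk_iff_sub_mem _ _).1 (congrFun (hG i) j)
  have h := (I i).add_mem ((I i).add_mem h₁ h₂) h₃
  rw [one_pow, one_mul]
  convert h using 1
  change _ = A.1 i j - B.1 i j + (B.1 i j - (G i).1 i j) + ((G i).1 i j - (v i).1 j)
  ring

/-- Strong approximation for the coprime pair `I`, `J`: prescribe `B` modulo `I` and the identity
modulo `J`. -/
theorem exists_mem_principalCongr_map_eq {k : ℕ} {I J : Ideal R} (hJI : J ⊔ I = ⊤)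
    (husc : USC (I * J) ∨ I * J = ⊤) (B : SpecialLinearGroup (Fin (k + 1)) R) :
    ∃ A ∈ principalCongr k J, SpecialLinearGroup.map (Ideal.Quotient.mk I) A =
      SpecialLinearGroup.map (Ideal.Quotient.mk I) B := by
  have hco : Pairwise (Function.onFun IsCoprime fun b : Bool => cond b I J) := by
    have h : IsCoprime I J := by rwa [Ideal.isCoprime_iff_sup_eq, sup_comm]
    rintro (_ | _) (_ | _) hne
    exacts [absurd rfl hne, h.symm, h, absurd rfl hne]
  have hle : I * J ≤ ⨅ b : Bool, cond b I J :=
    le_iInf fun b => by cases b; exacts [Ideal.mul_le_right, Ideal.mul_le_left]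
  obtain ⟨A, hA⟩ := exists_forall_map_eq _ hco (hasStableRankOne_of_usc_or_eq_top husc hle)
    (fun b : Bool => cond b B 1)
  refine ⟨A, ?_, hA true⟩
  have h : SpecialLinearGroup.map (Ideal.Quotient.mk J) A =
    SpecialLinearGroup.map (Ideal.Quotient.mk J) 1 := hA false
  rwa [map_one] at h

theorem USC.of_le {I I' : Ideal R} (h : USC I) (hle : I ≤ I') (hI' : I' ≠ ⊤) : USC I' := by
  refine ⟨hI', fun n a ha => ?_⟩
  obtain ⟨b, hb, hu⟩ := h.2 n a ha
  exact ⟨b, hb, hu.map (Ideal.Quotient.factor hle)⟩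

end Quotient

end CongrSurj

theorem mainTheorem1 {R : Type*} [CommRing R] (k : ℕ) (hk : 1 ≤ k)
    (I : Fin (k + 1) → Ideal R) (hI : ∀ i j, i ≠ j → I i ⊔ I j = ⊤)
    (m : Fin (k + 1) → Fin (k + 1) → ℕ)
    (Γ : Subgroup (Matrix.SpecialLinearGroup (Fin (k + 1)) R)) :
    ((CongrSurj.USC (∏ i, I i) ∨ (∏ i, I i) = ⊤) →
      CongrSurj.IsCongruenceIdealSubgroup Γ →
      (Γ : Set (Matrix.SpecialLinearGroup (Fin (k + 1)) R)) *
        (CongrSurj.principalCongr k (∏ i, I i) :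
          Set (Matrix.SpecialLinearGroup (Fin (k + 1)) R)) = Set.univ →
      Function.Surjective (fun A : Γ => CongrSurj.rowMap I m A.1)) ∧
    (∀ J : Ideal R, CongrSurj.principalCongr k J ≤ Γ →
      J ⊔ (∏ i, I i) = ⊤ →
      (CongrSurj.USC ((∏ i, I i) * J) ∨ (∏ i, I i) * J = ⊤) →
      Function.Surjective (fun A : Γ => CongrSurj.rowMap I m A.1)) := by
  have hco : Pairwise (Function.onFun IsCoprime I) := fun i j hij =>
    Ideal.isCoprime_iff_sup_eq.2 (hI i j hij)
  refine ⟨fun husc _ hΓ => CongrSurj.rowMap_surjective hk I hco m Γ husc fun B => ?_,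
    fun J hJ hJI husc => CongrSurj.rowMap_surjective hk I hco m Γ ?_ fun B => ?_⟩
  · obtain ⟨A, hA, C, hC, hAC⟩ := Set.mem_mul.1 (hΓ.symm ▸ Set.mem_univ B)
    exact ⟨A, hA, CongrSurj.mem_principalCongr_iff.1 (by rwa [← hAC, inv_mul_cancel_left])⟩
  · by_cases h : ∏ i, I i = ⊤
    · exact Or.inr h
    -- The USC passes up from the product with `J` to the larger proper ideal `∏ i, I i`.
    · refine Or.inl ((husc.resolve_right fun h' => h ?_).of_le Ideal.mul_le_left h)
      exact top_le_iff.1 (h'.ge.trans Ideal.mul_le_left)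
  · obtain ⟨A, hA, hAB⟩ := CongrSurj.exists_mem_principalCongr_map_eq hJI husc B
    exact ⟨A, hJ hA, hAB⟩
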